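/- Let $G$ be a group, $\mathcal H$ a complex Hilbert space and $\mathcal B(\mathcal H)$ the algebra of bounded linear operators on $\mathcal H$. A map $T : G \to \mathcal B(\mathcal H)$ is called positive definite if $T(s^{-1}) = T(s)^*$ for every $s \in G$ and $$\sum_{s \in G} \sum_{t \in G} \langle T(t^{-1}s)h(s), h(t)\rangle \ge 0$$ for every finitely supported function $h : G \to \mathcal H$. Theorem. Let $N : G \to \mathcal B(\mathcal H)$ be a positive definite function such that $\{N(s) : s \in G\}$ is a family of commuting normal operators. Then for every integer $k \ge 0$ the function $N_k : G \to \mathcal B(\mathcal H)$, $N_k(s) = N(s)^k$ (with $N(s)^0 = I_{\mathcal H}$), is positive definite. -/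

import Mathlib

open scoped ComplexOrder

/-- An operator-valued function `T : G → B(H)` on a group is positive definite if
`T(s⁻¹) = T(s)*` for all `s` and `∑ₛ ∑ₜ ⟨T(t⁻¹ s) h(s), h(t)⟩ ≥ 0` for every finitely supported
`h : G → H`. Mathlib's `inner ℂ x y` is linear in `y`, so `⟨u, v⟩` linear in `u` is `inner ℂ v u`.
The inequality is in the order of `ℂ`: the sum is real and nonnegative. -/
structure IsPositiveDefiniteFunction {G H : Type*} [Group G] [NormedAddCommGroup H]
    [InnerProductSpace ℂ H] [CompleteSpace H] (T : G → H →L[ℂ] H) : Prop where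
  map_inv : ∀ s : G, T s⁻¹ = ContinuousLinearMap.adjoint (T s)
  sum_nonneg : ∀ h : G →₀ H,
    0 ≤ ∑ s ∈ h.support, ∑ t ∈ h.support, inner ℂ (h t) (T (t⁻¹ * s) (h s))

/-- The pointwise power `T_n(s) = T(s)^n`, where the power is iterated composition. -/
def powerFunction {G H : Type*} [NormedAddCommGroup H] [InnerProductSpace ℂ H]
    (T : G → H →L[ℂ] H) (n : ℕ) : G → H →L[ℂ] H :=
  fun s => T s ^ n

/-! Positive definiteness makes every finite matrix `N (t⁻¹ * s)` positive, and powers are iterated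
Schur products, so it suffices to multiply positive matrices `A`, `B` with mutually commuting
entries (`IsPositiveKernel.mul`). Write `A = C* C` with `C` the square root of the block operator.
The entries of `C` commute with those of `B`, so the form of the Schur product at `v` is a sum over
`k` of forms of `B` at the vectors `C k i (v i)`. -/

section BlockOperators

variable {ι H : Type*} [NormedAddCommGroup H] [InnerProductSpace ℂ H]

/-- A finite operator matrix is positive if its quadratic form on `ι → H` is nonnegative. -/
def IsPositiveKernel [Fintype ι] (A : ι → ι → H →L[ℂ] H) : Prop :=
  ∀ v : ι → H, 0 ≤ ∑ i, ∑ j, inner ℂ (v i) (A i j (v j))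

lemma isPositiveKernel_one [Fintype ι] : IsPositiveKernel fun _ _ : ι => (1 : H →L[ℂ] H) := by
  intro v
  have h : ∑ i, ∑ j, inner ℂ (v i) ((1 : H →L[ℂ] H) (v j)) = inner ℂ (∑ i, v i) (∑ j, v j) := by
    simp_rw [sum_inner, inner_sum, one_apply_eq_self]
  rw [h]
  rw [inner_self_eq_norm_sq_to_K]
  positivity

/-- The operator on the Hilbert sum of copies of `H` with the given matrix of operators. -/
noncomputable def blockOperator [Fintype ι] (A : ι → ι → H →L[ℂ] H) :
    PiLp 2 (fun _ : ι => H) →L[ℂ] PiLp 2 (fun _ : ι => H) :=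
  ((PiLp.continuousLinearEquiv 2 ℂ (fun _ : ι => H)).symm :
      (ι → H) →L[ℂ] PiLp 2 (fun _ : ι => H)) ∘L
    ContinuousLinearMap.pi fun i => ∑ j, A i j ∘L PiLp.proj 2 (fun _ : ι => H) j

@[simp]
lemma blockOperator_apply [Fintype ι] (A : ι → ι → H →L[ℂ] H) (x : PiLp 2 (fun _ : ι => H))
    (i : ι) :
    blockOperator A x i = ∑ j, A i j (x j) := by
  simp [blockOperator]

lemma IsPositiveKernel.nonneg_blockOperator [Fintype ι] {A : ι → ι → H →L[ℂ] H}
    (hA : IsPositiveKernel A) :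
    0 ≤ blockOperator A := by
  rw [ContinuousLinearMap.nonneg_iff_isPositive, ContinuousLinearMap.isPositive_iff_complex]
  intro x
  have hx : 0 ≤ inner ℂ x (blockOperator A x) := by
    simpa [PiLp.inner_apply, inner_sum] using hA x
  have him := Complex.nonneg_iff.mp hx
  -- The value is real, so the two slots may be exchanged.
  rw [← Complex.conj_eq_iff_im.mpr him.2.symm, inner_conj_symm] at hx
  have him' := Complex.nonneg_iff.mp hx
  exact ⟨Complex.ext rfl him'.2, him'.1⟩

variable [DecidableEq ι]

/-- The inclusion of the `j`-th summand in the Hilbert sum. -/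
noncomputable def blockSingle (j : ι) : H →L[ℂ] PiLp 2 (fun _ : ι => H) :=
  ((PiLp.continuousLinearEquiv 2 ℂ (fun _ : ι => H)).symm :
      (ι → H) →L[ℂ] PiLp 2 (fun _ : ι => H)) ∘L
    ContinuousLinearMap.single ℂ (fun _ : ι => H) j

lemma blockSingle_apply (j : ι) (v : H) (i : ι) :
    blockSingle j v i = if i = j then v else 0 := by
  simp [blockSingle]

/-- The matrix entry of an operator on the Hilbert sum. -/
noncomputable def blockEntry (C : PiLp 2 (fun _ : ι => H) →L[ℂ] PiLp 2 (fun _ : ι => H))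
    (i j : ι) : H →L[ℂ] H :=
  PiLp.proj 2 (fun _ : ι => H) i ∘L C ∘L blockSingle j

lemma blockEntry_apply (C : PiLp 2 (fun _ : ι => H) →L[ℂ] PiLp 2 (fun _ : ι => H))
    (i j : ι) (v : H) : blockEntry C i j v = C (blockSingle j v) i := rfl

variable [Fintype ι]

lemma sum_blockSingle (x : PiLp 2 (fun _ : ι => H)) : ∑ j, blockSingle j (x j) = x := by
  ext i
  simp [blockSingle_apply]

lemma inner_blockSingle (j : ι) (v : H) (x : PiLp 2 (fun _ : ι => H)) :
    inner ℂ (blockSingle j v) x = inner ℂ v (x j) := by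
  rw [PiLp.inner_apply, Finset.sum_eq_single j]
  · simp [blockSingle_apply]
  · intro i _ hij
    simp [blockSingle_apply, hij]
  · simp

@[simp]
lemma blockEntry_blockOperator (A : ι → ι → H →L[ℂ] H) (i j : ι) :
    blockEntry (blockOperator A) i j = A i j := by
  ext v
  rw [blockEntry_apply, blockOperator_apply, Finset.sum_eq_single j]
  · simp [blockSingle_apply]
  · intro k _ hk
    simp [blockSingle_apply, hk]
  · simp

lemma blockEntry_mul (C D : PiLp 2 (fun _ : ι => H) →L[ℂ] PiLp 2 (fun _ : ι => H)) (i j : ι) :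
    blockEntry (C * D) i j = ∑ k, blockEntry C i k * blockEntry D k j := by
  ext v
  have h : C (D (blockSingle j v)) = ∑ k, C (blockSingle k (D (blockSingle j v) k)) := by
    rw [← map_sum, sum_blockSingle]
  rw [sum_apply, blockEntry_apply]
  change (C (D (blockSingle j v))) i = _
  rw [h, WithLp.ofLp_sum, Finset.sum_apply]
  rfl

/-- Multiplying by the diagonal operator with entries `D` multiplies each entry by `D`, on the
matching side. -/
lemma commute_blockEntry {C : PiLp 2 (fun _ : ι => H) →L[ℂ] PiLp 2 (fun _ : ι => H)}
    {D : H →L[ℂ] H} (h : Commute C (blockOperator fun i j => if i = j then D else 0)) (i j : ι) :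
    Commute (blockEntry C i j) D := by
  have h' := congrArg (fun X => blockEntry X i j) h.eq
  simpa [blockEntry_mul, mul_ite, ite_mul, commute_iff_eq] using h'

lemma commute_blockOperator_diagonal {A : ι → ι → H →L[ℂ] H} {D : H →L[ℂ] H}
    (h : ∀ i j, Commute (A i j) D) :
    Commute (blockOperator A) (blockOperator fun i j => if i = j then D else 0) := by
  refine ContinuousLinearMap.ext fun x => ?_
  ext i
  have h' : ∀ i j y, A i j (D y) = D (A i j y) := fun i j y => congrArg (· y) (h i j).eq
  change blockOperator A (blockOperator _ x) i = blockOperator _ (blockOperator A x) i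
  have hD : ∀ (y : PiLp 2 (fun _ : ι => H)) (k : ι),
      blockOperator (fun i j => if i = j then D else 0) y k = D (y k) := by
    intro y k
    rw [blockOperator_apply, Finset.sum_eq_single k]
    · simp
    · intro l _ hl
      simp [hl.symm]
    · simp
  rw [hD, blockOperator_apply, blockOperator_apply, map_sum]
  exact Finset.sum_congr rfl fun j _ => by rw [hD, h']

variable [CompleteSpace H]

lemma adjoint_blockEntry {C : PiLp 2 (fun _ : ι => H) →L[ℂ] PiLp 2 (fun _ : ι => H)}
    (i j : ι) : ContinuousLinearMap.adjoint (blockEntry C i j) =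
      blockEntry (ContinuousLinearMap.adjoint C) j i := by
  symm
  rw [ContinuousLinearMap.eq_adjoint_iff]
  intro x y
  rw [blockEntry_apply, blockEntry_apply, ← inner_blockSingle i x, ← inner_conj_symm,
    ← inner_blockSingle, inner_conj_symm, ContinuousLinearMap.adjoint_inner_left]

/-- The functional calculus of `A` preserves commutation with `D`. -/
lemma exists_selfAdjoint_sqrt {A : H →L[ℂ] H} (hA : 0 ≤ A) :
    ∃ C : H →L[ℂ] H, ContinuousLinearMap.adjoint C = C ∧ C * C = A ∧
      ∀ D, Commute A D → Commute C D :=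
  ⟨CFC.sqrt A, (IsSelfAdjoint.of_nonneg (CFC.sqrt_nonneg A)).star_eq,
    CFC.sqrt_mul_sqrt_self A hA, fun _ h => h.cfcₙ_nnreal _⟩

/-- A positive operator matrix is of the form `C* C` for a matrix `C` whose entries lie in
the commutant of every operator commuting with the original entries. -/
lemma IsPositiveKernel.exists_factorization {A : ι → ι → H →L[ℂ] H} (hA : IsPositiveKernel A) :
    ∃ C : ι → ι → H →L[ℂ] H,
      (∀ i j, A i j = ∑ k, ContinuousLinearMap.adjoint (C k i) * C k j) ∧
      ∀ D : H →L[ℂ] H, (∀ i j, Commute (A i j) D) → ∀ i j, Commute (C i j) D := by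
  obtain ⟨C, hC, hCC, hcomm⟩ := exists_selfAdjoint_sqrt hA.nonneg_blockOperator
  refine ⟨blockEntry C, fun i j => ?_, fun D hD =>
    commute_blockEntry (hcomm _ (commute_blockOperator_diagonal hD))⟩
  simp_rw [adjoint_blockEntry, hC]
  rw [← blockEntry_mul, hCC, blockEntry_blockOperator]

/-- The Schur product of two positive operator matrices with mutually commuting entries
is positive. -/
lemma IsPositiveKernel.mul {A B : ι → ι → H →L[ℂ] H} (hA : IsPositiveKernel A)
    (hB : IsPositiveKernel B) (hAB : ∀ i j k l, Commute (A i j) (B k l)) :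
    IsPositiveKernel fun i j => A i j * B i j := by
  obtain ⟨C, hC, hcomm⟩ := hA.exists_factorization
  intro v
  have key : ∀ i j, inner ℂ (v i) ((A i j * B i j) (v j)) =
      ∑ k, inner ℂ (C k i (v i)) (B i j (C k j (v j))) := by
    intro i j
    rw [hC i j, mul_apply_eq_comp, sum_apply, inner_sum]
    refine Finset.sum_congr rfl fun k _ => ?_
    -- Commutation lets `C k j` reach `v j`, while the adjoint of `C k i` moves to the left slot.
    have h : C k j (B i j (v j)) = B i j (C k j (v j)) :=
      congrArg (· (v j)) (hcomm (B i j) (fun p q => hAB p q i j) k j).eq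
    rw [mul_apply_eq_comp, ContinuousLinearMap.adjoint_inner_right, h]
  have hsum : ∑ i, ∑ j, inner ℂ (v i) ((A i j * B i j) (v j)) =
      ∑ k, ∑ i, ∑ j, inner ℂ (C k i (v i)) (B i j (C k j (v j))) := by
    simp_rw [key]
    rw [Finset.sum_comm (s := Finset.univ) (t := Finset.univ)
      (f := fun k i => ∑ j, inner ℂ (C k i (v i)) (B i j (C k j (v j))))]
    exact Finset.sum_congr rfl fun i _ => Finset.sum_comm
  rw [hsum]
  exact Finset.sum_nonneg fun k _ => hB fun i => C k i (v i)

lemma IsPositiveKernel.pow {A : ι → ι → H →L[ℂ] H} (hA : IsPositiveKernel A)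
    (hcomm : ∀ i j k l, Commute (A i j) (A k l)) (n : ℕ) :
    IsPositiveKernel fun i j => A i j ^ n := by
  induction n with
  | zero => simpa using isPositiveKernel_one
  | succ n ih =>
    simpa only [pow_succ'] using hA.mul ih fun i j k l => (hcomm i j k l).pow_right n

end BlockOperators

lemma IsPositiveDefiniteFunction.isPositiveKernel {G H : Type*} [Group G] [NormedAddCommGroup H]
    [InnerProductSpace ℂ H] [CompleteSpace H] {T : G → H →L[ℂ] H}
    (hT : IsPositiveDefiniteFunction T) (S : Finset G) :
    IsPositiveKernel fun t s : S => T ((t : G)⁻¹ * s) := by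
  classical
  intro v
  -- Extension of `v` by zero; its support may be smaller than `S`.
  set h : G →₀ H := Finsupp.indicator S fun s hs => v ⟨s, hs⟩ with hh
  have hv : ∀ s : S, h s = v s := fun s => by simp [hh]
  have hsub : h.support ⊆ S := Finsupp.support_indicator_subset _ _
  have h0 := hT.sum_nonneg h
  have e : ∑ s ∈ h.support, ∑ t ∈ h.support, inner ℂ (h t) (T (t⁻¹ * s) (h s)) =
      ∑ s ∈ S, ∑ t ∈ S, inner ℂ (h t) (T (t⁻¹ * s) (h s)) := by
    have hin : ∀ s, ∑ t ∈ h.support, inner ℂ (h t) (T (t⁻¹ * s) (h s)) =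
        ∑ t ∈ S, inner ℂ (h t) (T (t⁻¹ * s) (h s)) := fun s =>
      Finset.sum_subset hsub fun t _ ht => by simp [Finsupp.notMem_support_iff.mp ht]
    simp_rw [hin]
    exact Finset.sum_subset hsub fun s _ hs => by simp [Finsupp.notMem_support_iff.mp hs]
  -- The row index of the kernel is `t`, the inner summation variable.
  rw [e, Finset.sum_comm, ← Finset.sum_coe_sort] at h0
  simp_rw [← Finset.sum_coe_sort S] at h0
  simpa only [hv] using h0

theorem mainTheorem7 {G H : Type*} [Group G] [NormedAddCommGroup H] [InnerProductSpace ℂ H]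
    [CompleteSpace H] (N : G → H →L[ℂ] H) (hN : IsPositiveDefiniteFunction N)
    (hnormal : ∀ s : G, IsStarNormal (N s)) (hcomm : ∀ s t : G, Commute (N s) (N t)) (k : ℕ) :
    IsPositiveDefiniteFunction (powerFunction N k) := by
  classical
  refine ⟨fun s => ?_, fun h => ?_⟩
  · rw [powerFunction, powerFunction, hN.map_inv, ← ContinuousLinearMap.star_eq_adjoint,
      ← ContinuousLinearMap.star_eq_adjoint, star_pow]
  · have hk := (hN.isPositiveKernel h.support).pow (fun _ _ _ _ => hcomm _ _) k
      fun s => h s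
    rw [Finset.sum_comm, ← Finset.sum_coe_sort]
    simp_rw [← Finset.sum_coe_sort h.support]
    exact hk
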